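/- Let $A$ be an associative ring with $1$, let $J$ be its Jacobson radical, and suppose that $A$ is semiprimary (that is, $A/J$ is semisimple and $J$ is nilpotent) and left self-injective (that is, $A$ is injective as a left $A$-module). Write $|X|$ for the cardinality of a set $X$. (1) If $|A/J|\le\aleph_0$, then $A$ is quasi-Frobenius (QF). (2) If $|A/J|<|A|$, then $A$ is quasi-Frobenius (QF). Here a ring is called quasi-Frobenius if it is left and right artinian and left and right self-injective. -/

import Mathlib

/-- A ring `A` is left self-injective if it is injective as a left module over itself. -/
def IsLeftSelfInjective (A : Type*) [Ring A] : Prop :=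
  Module.Injective A A

/-- A ring `A` is right self-injective if it is injective as a right module over itself; right
`A`-modules are modules over the opposite ring `Aᵐᵒᵖ`, which acts on `A` by right
multiplication. -/
def IsRightSelfInjective (A : Type*) [Ring A] : Prop :=
  Module.Injective Aᵐᵒᵖ A

/-- A ring is quasi-Frobenius (QF) if it is artinian and self-injective, on both sides. -/
structure IsQuasiFrobenius (A : Type*) [Ring A] : Prop where
  left_artinian : IsArtinian A A
  right_artinian : IsArtinian Aᵐᵒᵖ A
  left_selfInjective : IsLeftSelfInjective A
  right_selfInjective : IsRightSelfInjective A

-- Duality `M ↦ Hom(M, A)` drives the proof. Self-injectivity makes it exact, and A is also a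
-- cogenerator: the left annihilator of the left socle S is J, so every simple left module embeds in
-- A (`mem_jacobson_of_mul_leftSocle_eq_zero`). Hence a direct sum of ι nonzero modules has at least
-- 2^|ι| functionals. By Cantor, a semisimple module with at most κ functionals has fewer than κ
-- summands: finitely many if κ = ℵ₀, and the module has fewer than κ elements if κ > ℵ₀ and κ >
-- |A/J|. Both conclusions pass through extensions, hence hold for all modules.
--
-- A has at most |A| functionals. If A is uncountable and |A/J| < |A|, this gives |A| < |A|; so A is
-- countable and therefore left artinian. Double annihilator arguments then give the right-hand
-- conditions.

universe u

/-! ### Self-injectivity and double annihilators of right ideals -/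

section Annihilators

variable {A : Type u} [Ring A]

/-- The left annihilator of a set, as a left ideal. -/
def leftAnnihilator (X : Set A) : Ideal A where
  carrier := {a | ∀ x ∈ X, a * x = 0}
  add_mem' ha hb x hx := by rw [add_mul, ha x hx, hb x hx, add_zero]
  zero_mem' x _ := zero_mul x
  smul_mem' c a ha x hx := by rw [smul_eq_mul, mul_assoc, ha x hx, mul_zero]

theorem mem_leftAnnihilator {X : Set A} {a : A} :
    a ∈ leftAnnihilator X ↔ ∀ x ∈ X, a * x = 0 := Iff.rfl

theorem leftAnnihilator_anti {X Y : Set A} (h : X ⊆ Y) :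
    leftAnnihilator Y ≤ leftAnnihilator X := fun _ ha x hx ↦ ha x (h hx)

namespace IsLeftSelfInjective

/-- Linear maps into a left self-injective ring factor through any map with smaller kernel. -/
theorem exists_comp_eq_of_ker_le (hA : IsLeftSelfInjective A) {X N : Type u} [AddCommGroup X]
    [Module A X] [AddCommGroup N] [Module A N] (f : X →ₗ[A] N) (g : X →ₗ[A] A)
    (h : LinearMap.ker f ≤ LinearMap.ker g) : ∃ k : N →ₗ[A] A, ∀ x, k (f x) = g x := by
  obtain ⟨k, hk⟩ := Module.Injective.out (self := hA) ((LinearMap.ker f).liftQ f le_rfl)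
    (LinearMap.ker_eq_bot.mp (Submodule.ker_liftQ_eq_bot _ _ _ le_rfl))
    ((LinearMap.ker f).liftQ g h)
  exact ⟨k, fun x ↦ by simpa using hk (Submodule.Quotient.mk x)⟩

/-- Finitely generated right ideals of a left self-injective ring are right annihilators. -/
theorem mem_span_of_finset (hA : IsLeftSelfInjective A) (F : Finset A) (x : A)
    (hx : ∀ a, (∀ y ∈ F, a * y = 0) → a * x = 0) : x ∈ Submodule.span Aᵐᵒᵖ (F : Set A) := by
  classical
  -- Right multiplication by `x` factors through `a ↦ (a * y)` into `A^F`; the values of `k` on the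
  -- standard basis are the coefficients of `x`.
  obtain ⟨k, hk⟩ := hA.exists_comp_eq_of_ker_le
    (LinearMap.pi fun y : F ↦ LinearMap.toSpanSingleton A A y.1)
    (LinearMap.toSpanSingleton A A x) (fun a ha ↦ by
      rw [LinearMap.mem_ker] at ha ⊢
      exact hx a fun y hy ↦ by simpa using congrFun ha ⟨y, hy⟩)
  have h1 := hk 1
  rw [LinearMap.toSpanSingleton_apply, one_smul, LinearMap.pi_apply_eq_sum_univ] at h1
  rw [← h1]
  refine Submodule.sum_mem _ fun y _ ↦ ?_
  have : y.1 ∈ Submodule.span Aᵐᵒᵖ (F : Set A) := Submodule.subset_span y.2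
  simpa using Submodule.smul_mem _ (MulOpposite.op (k fun j ↦ if y = j then 1 else 0)) this

/-- A right ideal whose left annihilator is coartinian is a right annihilator. -/
theorem mem_of_isArtinian_quotient (hA : IsLeftSelfInjective A) (K : Ideal A)
    [IsArtinian A (A ⧸ K)] (R : Submodule Aᵐᵒᵖ A) (hK : K ≤ leftAnnihilator (R : Set A)) {x : A}
    (hx : ∀ a ∈ leftAnnihilator (R : Set A), a * x = 0) : x ∈ R := by
  classical
  let 𝓕 := {F : Finset A // (F : Set A) ⊆ R}
  let φ : 𝓕 → Submodule A (A ⧸ K) := fun F ↦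
    Submodule.map K.mkQ (leftAnnihilator (F.1 : Set A))
  have key : ∀ (F : 𝓕) (a : A), K.mkQ a ∈ φ F → a ∈ leftAnnihilator (F.1 : Set A) := by
    rintro F a ⟨b, hb, hab⟩
    have h : b - a ∈ K := (Submodule.Quotient.eq K).mp hab
    have h2 := leftAnnihilator_anti F.2 (hK h)
    simpa using sub_mem hb h2
  -- By minimality, a finite `F ⊆ R` already has the same left annihilator as `R`.
  obtain ⟨_, ⟨F, rfl⟩, hF⟩ := WellFounded.has_min (wellFounded_lt (α := Submodule A (A ⧸ K)))
    (Set.range φ) ⟨_, ⟨⟨∅, by simp⟩, rfl⟩⟩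
  have hle : leftAnnihilator (F.1 : Set A) ≤ leftAnnihilator (R : Set A) := by
    intro a ha r hr
    let F' : 𝓕 := ⟨insert r F.1, by
      rw [Finset.coe_insert]; exact Set.insert_subset hr F.2⟩
    have h1 : φ F' ≤ φ F := Submodule.map_mono (leftAnnihilator_anti (by simp [F']))
    have h2 : φ F' = φ F := by
      by_contra hne
      exact hF _ ⟨F', rfl⟩ (lt_of_le_of_ne h1 hne)
    exact key F' a (h2 ▸ ⟨a, ha, rfl⟩) r (by simp [F'])
  exact Submodule.span_le.mpr F.2 (hA.mem_span_of_finset F.1 x fun a ha ↦ hx a (hle ha))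

end IsLeftSelfInjective

end Annihilators

/-! ### Socle, radical and the cogenerator property -/

section Semiprimary

variable {A : Type u} [Ring A] [IsSemiprimaryRing A]

/-- The left socle of a semiprimary ring, described as the right annihilator of the radical. -/
def leftSocle (A : Type u) [Ring A] : Set A := {s | ∀ j ∈ Ring.jacobson A, j * s = 0}

theorem mul_mem_leftSocle_left {A : Type u} [Ring A] {s : A} (a : A) (hs : s ∈ leftSocle A) :
    a * s ∈ leftSocle A := fun j hj ↦ by
  rw [← mul_assoc]; exact hs _ (Ideal.mul_mem_right a _ hj)

theorem mul_mem_leftSocle_right {A : Type u} [Ring A] {s : A} (a : A) (hs : s ∈ leftSocle A) :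
    s * a ∈ leftSocle A := fun j hj ↦ by
  rw [← mul_assoc, hs j hj, zero_mul]

/-- The left socle of a semiprimary ring is essential. -/
theorem exists_mul_mem_leftSocle {x : A} (hx : x ≠ 0) : ∃ c, c * x ≠ 0 ∧ c * x ∈ leftSocle A := by
  obtain ⟨n, hn⟩ := IsSemiprimaryRing.isNilpotent (R := A)
  have : ∀ n (x : A), x ≠ 0 → (∀ j ∈ Ring.jacobson A ^ n, j * x = 0) →
      ∃ c, c * x ≠ 0 ∧ c * x ∈ leftSocle A := by
    intro n
    induction n with
    | zero => intro x hx h; exact absurd (by simpa using h 1 (by rw [Submodule.pow_zero]; simp)) hx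
    | succ n ih =>
      intro x hx h
      by_cases hJ : ∀ j ∈ Ring.jacobson A, j * x = 0
      · exact ⟨1, by rwa [one_mul], by rwa [one_mul]⟩
      · push Not at hJ
        obtain ⟨j, hj, hjx⟩ := hJ
        obtain ⟨c, hc⟩ := ih (j * x) hjx fun i hi ↦ by
          rw [← mul_assoc]
          exact h _ (by rw [Submodule.pow_succ]; exact Ideal.mul_mem_mul hi hj)
        exact ⟨c * j, by simpa [mul_assoc] using hc⟩
  exact this n x hx fun j hj ↦ by
    rw [hn] at hj
    rw [show j = 0 from hj, zero_mul]

/-- A left ideal of a semiprimary ring has a right identity modulo the radical. -/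
theorem exists_right_identity_mod_jacobson (I : Ideal A) :
    ∃ e ∈ I, ∀ m ∈ I, m - m * e ∈ Ring.jacobson A := by
  obtain ⟨e', he', heq⟩ := IsSemisimpleRing.ideal_eq_span_idempotent
    (I.map (Ideal.Quotient.mk (Ring.jacobson A)))
  obtain ⟨e, heI, rfl⟩ := (Ideal.mem_map_iff_of_surjective _ Ideal.Quotient.mk_surjective).mp
    (heq ▸ Ideal.mem_span_singleton_self e')
  refine ⟨e, heI, fun m hm ↦ ?_⟩
  have := Ideal.mem_map_of_mem (Ideal.Quotient.mk (Ring.jacobson A)) hm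
  rw [heq] at this
  obtain ⟨b, hb⟩ := Ideal.mem_span_singleton'.mp this
  rw [← Ideal.Quotient.eq_zero_iff_mem, map_sub, map_mul, ← hb, mul_assoc, he'.eq, sub_self]

/-- A semiprimary ring has finitely many two-sided ideals containing its radical. -/
theorem finite_twoSided_jacobson_le :
    Finite {I : Ideal A // I.IsTwoSided ∧ Ring.jacobson A ≤ I} := by
  let B := A ⧸ Ring.jacobson A
  -- Two-sided ideals of the semisimple ring `B` correspond to sets of its finitely many isotypic
  -- components.
  have : Finite (fullyInvariantSubmodule B B) :=
    Finite.of_equiv _ (OrderIso.setIsotypicComponents (R := B) (M := B)).toEquiv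
  have hs : Function.Surjective (Ideal.Quotient.mk (Ring.jacobson A)) :=
    Ideal.Quotient.mk_surjective
  have htw : ∀ I : {I : Ideal A // I.IsTwoSided ∧ Ring.jacobson A ≤ I},
      (I.1.map (Ideal.Quotient.mk (Ring.jacobson A))).IsTwoSided := by
    rintro ⟨I, hI, hJ⟩
    refine ⟨fun {a} b ha ↦ ?_⟩
    obtain ⟨a, haI, rfl⟩ := (Ideal.mem_map_iff_of_surjective _ hs).mp ha
    obtain ⟨b, rfl⟩ := hs b
    rw [← map_mul]
    exact Ideal.mem_map_of_mem _ (hI.mul_mem_of_left b haI)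
  refine Finite.of_injective (β := fullyInvariantSubmodule B B)
    (fun I ↦ ⟨I.1.map (Ideal.Quotient.mk (Ring.jacobson A)),
      isFullyInvariant_iff_isTwoSided.mpr (htw I)⟩) fun I I' h ↦ Subtype.ext ?_
  have h2 : I.1.map (Ideal.Quotient.mk (Ring.jacobson A)) =
    I'.1.map (Ideal.Quotient.mk (Ring.jacobson A)) := congrArg Subtype.val h
  have h3 : ∀ I I' : {I : Ideal A // I.IsTwoSided ∧ Ring.jacobson A ≤ I},
      I.1.map (Ideal.Quotient.mk (Ring.jacobson A)) =
        I'.1.map (Ideal.Quotient.mk (Ring.jacobson A)) → I.1 ≤ I'.1 := by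
    intro I I' h a ha
    obtain ⟨b, hb, hab⟩ := (Ideal.mem_map_iff_of_surjective _ hs).mp
      (h ▸ Ideal.mem_map_of_mem (Ideal.Quotient.mk (Ring.jacobson A)) ha)
    have := I'.2.2 (Ideal.Quotient.eq.mp hab)
    simpa using sub_mem hb this
  exact le_antisymm (h3 I I' h2) (h3 I' I h2.symm)

instance isArtinian_quotient_jacobson : IsArtinian A (A ⧸ Ring.jacobson A) := by
  let f : (A ⧸ Ring.jacobson A) →ₛₗ[Ideal.Quotient.mk (Ring.jacobson A)] (A ⧸ Ring.jacobson A) :=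
    ⟨.id _, fun _ _ ↦ rfl⟩
  rw [f.isArtinian_iff_of_bijective Function.bijective_id]
  infer_instance

namespace IsLeftSelfInjective

/-- Right multiplication by `1 + a` fixes the essential left socle pointwise, so it is injective,
and injectivity of A splits it. -/
theorem exists_mul_eq_one_of_leftSocle_mul_eq_zero (hA : IsLeftSelfInjective A) {a : A}
    (ha : ∀ s ∈ leftSocle A, s * a = 0) : ∃ v, (1 + a) * v = 1 := by
  obtain ⟨k, hk⟩ := hA.exists_comp_eq_of_ker_le (LinearMap.toSpanSingleton A A (1 + a))
    LinearMap.id fun c hc ↦ by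
      rw [LinearMap.mem_ker, LinearMap.toSpanSingleton_apply, smul_eq_mul] at hc
      by_contra h0
      obtain ⟨d, hd, hdS⟩ := exists_mul_mem_leftSocle (x := c) h0
      apply hd
      have := congrArg (d * ·) hc
      simpa [mul_add, ← mul_assoc, ha _ hdS] using this
  refine ⟨k 1, ?_⟩
  have h1 := hk 1
  rw [LinearMap.toSpanSingleton_apply, one_smul] at h1
  rw [← smul_eq_mul, ← map_smul, smul_eq_mul, mul_one]
  exact h1

/-- The right inverse `v` of `1 + y * a` is again of the form 1 plus an element killed by the socle,
so it has a right inverse too and is a two-sided inverse. -/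
theorem mem_jacobson_of_leftSocle_mul_eq_zero (hA : IsLeftSelfInjective A) {a : A}
    (ha : ∀ s ∈ leftSocle A, s * a = 0) : a ∈ Ring.jacobson A := by
  rw [← Ideal.jacobson_bot, Ideal.mem_jacobson_iff]
  intro y
  have hy : ∀ s ∈ leftSocle A, s * (y * a) = 0 := fun s hs ↦ by
    rw [← mul_assoc, ha _ (mul_mem_leftSocle_right y hs)]
  obtain ⟨v, hv⟩ := hA.exists_mul_eq_one_of_leftSocle_mul_eq_zero hy
  obtain ⟨w, hw⟩ := hA.exists_mul_eq_one_of_leftSocle_mul_eq_zero (a := -(y * a * v))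
    fun s hs ↦ by rw [mul_neg, ← mul_assoc, hy s hs, zero_mul, neg_zero]
  have hv' : 1 + -(y * a * v) = v := by
    rw [← hv]; noncomm_ring
  rw [hv'] at hw
  have huw : w = 1 + y * a := by
    rw [← one_mul w, ← hv, mul_assoc, hw, mul_one, hv]
  refine ⟨v, ?_⟩
  rw [huw] at hw
  rw [Submodule.mem_bot, sub_eq_zero, ← hw]
  noncomm_ring

/-- The left socle of a left self-injective semiprimary ring is killed by the radical on the
right. -/
theorem leftSocle_mul_jacobson (hA : IsLeftSelfInjective A) {s j : A} (hs : s ∈ leftSocle A)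
    (hj : j ∈ Ring.jacobson A) : s * j = 0 := by
  let I : Ideal A := leftAnnihilator {s * j}
  have hI : ∀ a, a ∈ I ↔ a * (s * j) = 0 := fun a ↦ by simp [I, mem_leftAnnihilator]
  obtain ⟨e, heI, he⟩ := exists_right_identity_mod_jacobson I
  -- If `a * (x * j) = 0` then `a ∈ I`, so `a - a * e ∈ J` kills `s`, i.e. `a * x = 0`. Hence `x` is
  -- a right multiple of `x * j`, and nilpotence of J forces `x = 0`.
  let x := s - e * s
  have hxj : x * j = s * j := by
    simp [x, sub_mul, mul_assoc, (hI e).mp heI]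
  obtain ⟨k, hk⟩ := hA.exists_comp_eq_of_ker_le (LinearMap.toSpanSingleton A A (x * j))
    (LinearMap.toSpanSingleton A A x) fun a ha ↦ by
      rw [LinearMap.mem_ker, LinearMap.toSpanSingleton_apply, smul_eq_mul] at ha ⊢
      have h2 := hs _ (he a ((hI a).mpr (hxj ▸ ha)))
      simpa [x, mul_sub, sub_mul, mul_assoc] using h2
  have hx : x * (j * k 1) = x := by
    have h1 := hk 1
    rw [LinearMap.toSpanSingleton_apply, LinearMap.toSpanSingleton_apply, one_smul, one_smul] at h1
    rw [← mul_assoc, ← smul_eq_mul, ← map_smul, smul_eq_mul, mul_one, h1]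
  have hpow : ∀ n, x * (j * k 1) ^ n = x := by
    intro n
    induction n with
    | zero => simp
    | succ n ih => rw [pow_succ, ← mul_assoc, ih, hx]
  obtain ⟨n, hn⟩ := IsSemiprimaryRing.isNilpotent (R := A)
  have h0 := Submodule.pow_mem_pow _ (Ideal.mul_mem_right (k 1) _ hj) n
  rw [hn] at h0
  have hx0 : x = 0 := by rw [← hpow n, show (j * k 1) ^ n = 0 from h0, mul_zero]
  rw [← hxj, hx0, zero_mul]

/-- In a left self-injective semiprimary ring, the left annihilator of the left socle is the
radical. -/
theorem mem_jacobson_of_mul_leftSocle_eq_zero (hA : IsLeftSelfInjective A) {a : A}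
    (ha : ∀ s ∈ leftSocle A, a * s = 0) : a ∈ Ring.jacobson A := by
  let T := {I : Ideal A // I.IsTwoSided ∧ Ring.jacobson A ≤ I}
  have : Finite T := finite_twoSided_jacobson_le
  let X : Ideal A → Set A := fun I ↦ {x | ∃ s ∈ leftSocle A, ∃ i ∈ I, x = s * i}
  -- The map sends I to the left annihilator of SI. It is injective on a finite set, so J is a
  -- value; the left annihilator of S lies in that of every SI.
  let f : T → T := fun I ↦ ⟨leftAnnihilator (X I.1), by
    refine ⟨fun {a} b h ↦ ?_⟩
    rintro _ ⟨s, hs, i, hi, rfl⟩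
    rw [mul_assoc, ← mul_assoc b]
    exact h _ ⟨b * s, mul_mem_leftSocle_left b hs, i, hi, rfl⟩, by
    rintro j hj _ ⟨s, hs, i, hi, rfl⟩
    rw [← mul_assoc, hs j hj, zero_mul]⟩
  have key : ∀ I I' : T, f I = f I' → I.1 ≤ I'.1 := by
    intro I I' h b hb
    obtain ⟨e, heI, he⟩ := exists_right_identity_mod_jacobson I'.1
    have hsq : ∀ s ∈ leftSocle A, ∀ m ∈ I'.1, s * m * e = s * m := fun s hs m hm ↦ by
      have := hA.leftSocle_mul_jacobson hs (he m hm)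
      rw [mul_sub, sub_eq_zero] at this
      rw [mul_assoc, this]
    -- As a set this is SI', written through the idempotent-like `e` so that it is visibly closed
    -- under addition.
    let R : Submodule Aᵐᵒᵖ A :=
      { carrier := {x | x ∈ leftSocle A ∧ x * e = x}
        add_mem' := fun {x y} hx hy ↦ ⟨fun j hj ↦ by
          rw [mul_add, hx.1 j hj, hy.1 j hj, add_zero], by rw [add_mul, hx.2, hy.2]⟩
        zero_mem' := ⟨fun j _ ↦ mul_zero j, zero_mul e⟩
        smul_mem' := fun c x hx ↦ by
          refine ⟨mul_mem_leftSocle_right c.unop hx.1, ?_⟩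
          change x * c.unop * e = x * c.unop
          have := I'.2.1
          rw [← hx.2, mul_assoc x e]
          exact hsq x hx.1 _ (Ideal.mul_mem_right c.unop _ heI) }
    have hRX : (R : Set A) ⊆ X I'.1 := fun x hx ↦ ⟨x, hx.1, e, heI, hx.2.symm⟩
    have hann : leftAnnihilator (R : Set A) ≤ leftAnnihilator (X I'.1) := by
      rintro c hc _ ⟨s, hs, i, hi, rfl⟩
      exact hc _ ⟨mul_mem_leftSocle_right i hs, hsq s hs i hi⟩
    have hmem : ∀ s ∈ leftSocle A, s * b ∈ R := fun s hs ↦ by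
      refine hA.mem_of_isArtinian_quotient (Ring.jacobson A) R
        ((f I').2.2.trans (leftAnnihilator_anti hRX)) fun c hc ↦ ?_
      have h1 : c ∈ (f I).1 := h ▸ hann hc
      exact h1 _ ⟨s, hs, b, hb, rfl⟩
    have hJ : b - b * e ∈ Ring.jacobson A :=
      hA.mem_jacobson_of_leftSocle_mul_eq_zero fun s hs ↦ by
        rw [mul_sub, ← mul_assoc, (hmem s hs).2, sub_self]
    have := add_mem (I'.2.2 hJ) (I'.1.mul_mem_left b heI)
    rwa [sub_add_cancel] at this
  have hinj : Function.Injective f := fun I I' h ↦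
    Subtype.ext (le_antisymm (key I I' h) (key I' I h.symm))
  obtain ⟨I, hI⟩ := Finite.surjective_of_injective hinj
    ⟨Ring.jacobson A, inferInstance, le_rfl⟩
  have hmem : a ∈ (f I).1 := by
    rintro _ ⟨s, hs, i, hi, rfl⟩
    rw [← mul_assoc, ha s hs, zero_mul]
  rw [hI] at hmem
  exact hmem

/-- A left self-injective semiprimary ring is left Kasch: maximal left ideals have nonzero right
annihilators. -/
theorem exists_ne_zero_mul_eq_zero_of_isMaximal (hA : IsLeftSelfInjective A) (M : Ideal A)
    [hM : M.IsMaximal] : ∃ y, y ≠ 0 ∧ ∀ m ∈ M, m * y = 0 := by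
  obtain ⟨e, heM, he⟩ := exists_right_identity_mod_jacobson M
  have h1 : ¬ ∀ s ∈ leftSocle A, (1 - e) * s = 0 := fun h ↦ by
    have := add_mem (Ring.jacobson_le_of_isMaximal M (hA.mem_jacobson_of_mul_leftSocle_eq_zero h))
      heM
    rw [sub_add_cancel] at this
    exact hM.ne_top ((Ideal.eq_top_iff_one M).mpr this)
  push Not at h1
  obtain ⟨s, hs, hne⟩ := h1
  refine ⟨_, hne, fun m hm ↦ ?_⟩
  rw [← mul_assoc, mul_sub, mul_one]
  exact hs _ (he m hm)

/-- A left self-injective semiprimary ring is a cogenerator for its left modules. -/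
theorem exists_linearMap_apply_ne_zero (hA : IsLeftSelfInjective A) {N : Type u} [AddCommGroup N]
    [Module A N] {x : N} (hx : x ≠ 0) : ∃ h : N →ₗ[A] A, h x ≠ 0 := by
  have hne : LinearMap.ker (LinearMap.toSpanSingleton A N x) ≠ ⊤ := fun h ↦ hx <| by
    have : (1 : A) ∈ LinearMap.ker (LinearMap.toSpanSingleton A N x) := h ▸ Submodule.mem_top
    simpa using this
  obtain ⟨M, hM, hle⟩ := Ideal.exists_le_maximal _ hne
  obtain ⟨y, hy, hMy⟩ := hA.exists_ne_zero_mul_eq_zero_of_isMaximal M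
  obtain ⟨k, hk⟩ := hA.exists_comp_eq_of_ker_le (LinearMap.toSpanSingleton A N x)
    (LinearMap.toSpanSingleton A A y) fun a ha ↦ by simpa using hMy a (hle ha)
  exact ⟨k, by simpa using (hk 1).trans_ne (by simpa using hy)⟩

/-- Left ideals of a left self-injective semiprimary ring are left annihilators. -/
theorem exists_mul_ne_zero_of_notMem (hA : IsLeftSelfInjective A) {L : Ideal A} {x : A}
    (hx : x ∉ L) : ∃ y, (∀ a ∈ L, a * y = 0) ∧ x * y ≠ 0 := by
  obtain ⟨h, hh⟩ := hA.exists_linearMap_apply_ne_zero (x := Submodule.mkQ L x)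
    (by simpa using hx)
  have heq : ∀ a, a * h (Submodule.mkQ L 1) = h (Submodule.mkQ L a) := fun a ↦ by
    rw [← smul_eq_mul, ← map_smul, ← map_smul, smul_eq_mul, mul_one]
  refine ⟨h (Submodule.mkQ L 1), fun a ha ↦ ?_, by rwa [heq]⟩
  rw [heq, (Submodule.Quotient.mk_eq_zero L (x := a)).mpr ha |> fun h : Submodule.mkQ L a = 0 ↦ h,
    map_zero]

end IsLeftSelfInjective

end Semiprimary

/-! ### Counting linear functionals -/

section Cardinality

open Cardinal

variable {A : Type u} [Ring A]

theorem IsLeftSelfInjective.mk_linearMap_submodule_le (hA : IsLeftSelfInjective A) {M : Type u} [AddCommGroup M]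
    [Module A M] (N : Submodule A M) : #(N →ₗ[A] A) ≤ #(M →ₗ[A] A) := by
  refine mk_le_of_surjective (f := fun f : M →ₗ[A] A ↦ f ∘ₗ N.subtype) fun g ↦ ?_
  obtain ⟨k, hk⟩ := hA.exists_comp_eq_of_ker_le N.subtype g (by simp)
  exact ⟨k, LinearMap.ext hk⟩

theorem Cardinal.mk_linearMap_quotient_le {M : Type u} [AddCommGroup M]
    [Module A M] (N : Submodule A M) : #((M ⧸ N) →ₗ[A] A) ≤ #(M →ₗ[A] A) :=
  mk_le_of_injective (f := fun f : (M ⧸ N) →ₗ[A] A ↦ f ∘ₗ N.mkQ) fun _ _ h ↦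
    Submodule.linearMap_qext _ h

/-- A direct sum of simple modules killed by `J` has cardinality bounded in terms of the number of
summands and of `A ⧸ J`. -/
theorem Cardinal.mk_le_of_linearEquiv_dfinsupp {M ι : Type u} [AddCommGroup M]
    [Module A M] (J : Ideal A) (hJ : Module.IsTorsionBySet A M (J : Set A))
    {N : ι → Submodule A M} [∀ i, IsSimpleModule A (N i)] (e : M ≃ₗ[A] Π₀ i, N i) :
    #M ≤ max ℵ₀ (#ι * #(A ⧸ J)) := by
  classical
  have h : ∀ i, ∃ x : N i, x ≠ 0 := fun i ↦
    have := IsSimpleModule.nontrivial A (N i)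
    exists_ne 0
  choose v hv using h
  -- Each summand is cyclic and killed by J, so `A ⧸ J` parametrizes it; finite sums of values of
  -- `g` exhaust `M`.
  let g : ι × (A ⧸ J) → M := fun p ↦ e.symm (DFinsupp.single p.1 (p.2.out • v p.1))
  have hg : ∀ i (y : N i), e.symm (DFinsupp.single i y) ∈ Set.range g := by
    intro i y
    obtain ⟨a, rfl⟩ := IsSimpleModule.toSpanSingleton_surjective A (hv i) y
    refine ⟨⟨i, Submodule.Quotient.mk a⟩, ?_⟩
    have hmem : (Submodule.Quotient.mk (p := J) a).out - a ∈ J :=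
      (Submodule.Quotient.eq J).mp (Quotient.out_eq _)
    have h0 : ((Submodule.Quotient.mk (p := J) a).out - a) • v i = 0 :=
      Subtype.ext (@hJ (v i).1 ⟨_, hmem⟩)
    rw [sub_smul, sub_eq_zero] at h0
    simp only [g, h0, LinearMap.toSpanSingleton_apply]
  have htop : ∀ x : Π₀ i, N i, ∃ l : List (ι × (A ⧸ J)), (l.map g).sum = e.symm x := by
    intro x
    induction x using DFinsupp.induction with
    | h0 => exact ⟨[], by simp⟩
    | ha i b f _ _ ih =>
      obtain ⟨l, hl⟩ := ih
      obtain ⟨p, hp⟩ := hg i b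
      exact ⟨p :: l, by rw [List.map_cons, List.sum_cons, hl, hp, map_add]⟩
  have hsurj : Function.Surjective fun l : List (ι × (A ⧸ J)) ↦ (l.map g).sum := fun x ↦ by
    obtain ⟨l, hl⟩ := htop (e x)
    exact ⟨l, by simpa using hl⟩
  refine (mk_le_of_surjective hsurj).trans ((mk_list_le_max _).trans ?_)
  rw [mk_prod, lift_id, lift_id]

variable [IsSemiprimaryRing A]

namespace IsLeftSelfInjective

/-- A direct sum of nonzero modules over a left self-injective semiprimary ring has many linear
functionals. -/
theorem two_power_le_mk_linearMap (hA : IsLeftSelfInjective A) {M ι : Type u} [AddCommGroup M]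
    [Module A M] {N : ι → Submodule A M} [∀ i, Nontrivial (N i)] (e : M ≃ₗ[A] Π₀ i, N i) :
    2 ^ #ι ≤ #(M →ₗ[A] A) := by
  classical
  have h : ∀ i, ∃ (φ : N i →ₗ[A] A) (x : N i), φ x ≠ 0 := fun i ↦ by
    obtain ⟨x, hx⟩ := exists_ne (0 : N i)
    obtain ⟨φ, hφ⟩ := hA.exists_linearMap_apply_ne_zero hx
    exact ⟨φ, x, hφ⟩
  choose φ x hφ using h
  rw [← mk_set]
  -- Each `T ⊆ ι` gives the functional equal to `φ i` on summands in `T` and zero on the others;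
  -- evaluation at `x i` recovers `T`.
  refine mk_le_of_injective (f := fun T : Set ι ↦
    (DFinsupp.lsum ℕ fun i ↦ if i ∈ T then φ i else 0) ∘ₗ e.toLinearMap) fun T T' h ↦ ?_
  ext i
  have := congrArg (fun f ↦ f (e.symm (DFinsupp.single i (x i)))) h
  have hi := hφ i
  by_cases h1 : i ∈ T <;> by_cases h2 : i ∈ T' <;> simp [h1, h2, hi, hi.symm] at this ⊢

/-- Modules with countable dual are artinian. -/
theorem isArtinian_of_mk_linearMap_le (hA : IsLeftSelfInjective A) (M : Type u) [AddCommGroup M]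
    [Module A M] : #(M →ₗ[A] A) ≤ ℵ₀ → IsArtinian A M := by
  refine IsSemiprimaryRing.induction A A M
    (P := fun M _ _ _ ↦ #(M →ₗ[A] A) ≤ ℵ₀ → IsArtinian A M) ?_ ?_
  · intro M _ _ _ _ _ _ hM
    obtain ⟨s, e, -, hs⟩ := IsSemisimpleModule.exists_linearEquiv_dfinsupp A M
    have _ (m : s) : Nontrivial m.1 := IsSimpleModule.nontrivial A m.1
    have : Finite s := lt_aleph0_iff_finite.mp
      ((cantor _).trans_le ((hA.two_power_le_mk_linearMap e).trans hM))
    have := Fintype.ofFinite s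
    exact isArtinian_of_linearEquiv (e.trans DFinsupp.linearEquivFunOnFintype).symm
  · intro M _ _ _ _ N h1 h2 hM
    exact (isArtinian_iff_submodule_quotient N).mpr
      ⟨h1 ((hA.mk_linearMap_submodule_le N).trans hM),
        h2 ((mk_linearMap_quotient_le N).trans hM)⟩

/-- If `κ` is an uncountable cardinal larger than that of `A ⧸ J`, then a module with at most `κ`
linear functionals has fewer than `κ` elements. -/
theorem mk_lt_of_mk_linearMap_le (hA : IsLeftSelfInjective A) {κ : Cardinal.{u}} (hκ : ℵ₀ < κ)
    (hB : #(A ⧸ Ring.jacobson A) < κ) (M : Type u) [AddCommGroup M]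
    [Module A M] : #(M →ₗ[A] A) ≤ κ → #M < κ := by
  refine IsSemiprimaryRing.induction A A M
    (P := fun M _ _ _ ↦ #(M →ₗ[A] A) ≤ κ → #M < κ) ?_ ?_
  · intro M _ _ _ _ _ hJ hM
    obtain ⟨s, e, -, hs⟩ := IsSemisimpleModule.exists_linearEquiv_dfinsupp A M
    have _ (m : s) : Nontrivial m.1 := IsSimpleModule.nontrivial A m.1
    exact (mk_le_of_linearEquiv_dfinsupp _ hJ e).trans_lt (max_lt hκ
      (mul_lt_of_lt hκ.le ((cantor _).trans_le ((hA.two_power_le_mk_linearMap e).trans hM)) hB))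
  · intro M _ _ _ _ N h1 h2 hM
    rw [mk_congr (AddSubgroup.addGroupEquivQuotientProdAddSubgroup (s := N.toAddSubgroup)),
      mk_prod, lift_id, lift_id]
    exact mul_lt_of_lt hκ.le (h2 ((mk_linearMap_quotient_le N).trans hM))
      (h1 ((hA.mk_linearMap_submodule_le N).trans hM))

/-- A left self-injective semiprimary ring which is countable, or larger than its quotient by the
radical, is left artinian. -/
theorem isArtinian_of_mk (hA : IsLeftSelfInjective A)
    (h : #A ≤ ℵ₀ ∨ #(A ⧸ Ring.jacobson A) < #A) : IsArtinian A A := by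
  have hdual : #(A →ₗ[A] A) ≤ #A :=
    mk_le_of_injective (f := fun f : A →ₗ[A] A ↦ f 1) fun _ _ h ↦ LinearMap.ext_ring h
  by_cases hc : #A ≤ ℵ₀
  · exact hA.isArtinian_of_mk_linearMap_le A (hdual.trans hc)
  · exact absurd (hA.mk_lt_of_mk_linearMap_le (not_le.mp hc) (h.resolve_left hc) A hdual)
      (lt_irrefl _)

end IsLeftSelfInjective

end Cardinality

/-! ### From left artinian to quasi-Frobenius -/

section QuasiFrobenius

variable {A : Type u} [Ring A]

namespace IsLeftSelfInjective

/-- Each right ideal is recovered as the right annihilator of its left annihilator. Chain conditions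
thus transfer from left to right ideals, reversed. -/
theorem leftAnnihilator_strictAnti [IsArtinianRing A] (hA : IsLeftSelfInjective A) :
    StrictAnti fun R : Submodule Aᵐᵒᵖ A ↦ leftAnnihilator (R : Set A) := by
  intro R R' h
  refine lt_of_le_not_ge (leftAnnihilator_anti h.le) fun hle ↦ h.not_ge fun x hx ↦ ?_
  exact hA.mem_of_isArtinian_quotient ⊥ R bot_le fun a ha ↦ hle ha x hx

/-- Over a left artinian left self-injective ring, linear maps from finitely generated right ideals
to the ring are left multiplications. -/
theorem exists_eq_mul_of_fg [IsArtinianRing A] (hA : IsLeftSelfInjective A)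
    (R : Submodule Aᵐᵒᵖ A) (hR : R.FG) :
    ∀ g : R →ₗ[Aᵐᵒᵖ] A, ∃ c, ∀ x : R, g x = c * x := by
  induction R, hR using Submodule.fg_induction with
  | singleton a =>
    intro g
    have ha := Submodule.mem_span_singleton_self (R := Aᵐᵒᵖ) a
    -- Whatever `a` kills on the right also kills `g a`, and the left ideal `A a` is a left
    -- annihilator, so it contains `g a`.
    obtain ⟨c, hc⟩ : ∃ c, c * a = g ⟨a, ha⟩ := by
      by_contra h
      have hmem : g ⟨a, ha⟩ ∉ Ideal.span {a} := fun hm ↦ h (Ideal.mem_span_singleton'.mp hm)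
      obtain ⟨y, hy, hne⟩ := hA.exists_mul_ne_zero_of_notMem hmem
      apply hne
      have h1 : (MulOpposite.op y) • (⟨a, ha⟩ : Submodule.span Aᵐᵒᵖ {a}) = 0 :=
        Subtype.ext (hy a (Ideal.mem_span_singleton_self a))
      have h2 := map_smul g (MulOpposite.op y) ⟨a, ha⟩
      rw [h1, map_zero] at h2
      exact h2.symm
    refine ⟨c, fun x ↦ ?_⟩
    obtain ⟨b, hb⟩ := Submodule.mem_span_singleton.mp x.2
    have hx : x = b • ⟨a, ha⟩ := Subtype.ext hb.symm
    rw [hx, map_smul, ← hc]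
    exact mul_assoc c a b.unop
  | sup R₁ R₂ _ _ ih₁ ih₂ =>
    intro g
    obtain ⟨c₁, h₁⟩ := ih₁ (g ∘ₗ Submodule.inclusion le_sup_left)
    obtain ⟨c₂, h₂⟩ := ih₂ (g ∘ₗ Submodule.inclusion le_sup_right)
    -- The difference kills `R₁ ∩ R₂`, which is the right annihilator of this sum; the sum, being a
    -- left ideal, is a left annihilator. Splitting the difference reconciles the two multipliers.
    have hmem : c₁ - c₂ ∈ leftAnnihilator (R₁ : Set A) ⊔ leftAnnihilator (R₂ : Set A) := by
      by_contra h
      obtain ⟨y, hy, hne⟩ := hA.exists_mul_ne_zero_of_notMem h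
      have hy₁ : y ∈ R₁ := hA.mem_of_isArtinian_quotient ⊥ R₁ bot_le fun a ha ↦
        hy a (Submodule.mem_sup_left ha)
      have hy₂ : y ∈ R₂ := hA.mem_of_isArtinian_quotient ⊥ R₂ bot_le fun a ha ↦
        hy a (Submodule.mem_sup_right ha)
      apply hne
      rw [sub_mul, sub_eq_zero]
      exact (h₁ ⟨y, hy₁⟩).symm.trans (h₂ ⟨y, hy₂⟩)
    obtain ⟨l₁, hl₁, l₂, hl₂, hl⟩ := Submodule.mem_sup.mp hmem
    have hc : c₁ - l₁ = c₂ + l₂ := by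
      rw [sub_eq_iff_eq_add, add_assoc, add_comm l₂, hl]; abel
    refine ⟨c₁ - l₁, fun ⟨x, hx⟩ ↦ ?_⟩
    obtain ⟨x₁, hx₁, x₂, hx₂, rfl⟩ := Submodule.mem_sup.mp hx
    have e₁ : g ⟨x₁, Submodule.mem_sup_left hx₁⟩ = (c₁ - l₁) * x₁ := by
      rw [sub_mul, hl₁ x₁ hx₁, sub_zero]; exact h₁ ⟨x₁, hx₁⟩
    have e₂ : g ⟨x₂, Submodule.mem_sup_right hx₂⟩ = (c₁ - l₁) * x₂ := by
      rw [hc, add_mul, hl₂ x₂ hx₂, add_zero]; exact h₂ ⟨x₂, hx₂⟩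
    rw [mul_add, ← e₁, ← e₂, ← map_add]
    rfl

/-- A left artinian left self-injective ring is quasi-Frobenius. -/
theorem isQuasiFrobenius [IsArtinianRing A] (hA : IsLeftSelfInjective A) :
    IsQuasiFrobenius A where
  left_artinian := inferInstance
  right_artinian := hA.leftAnnihilator_strictAnti.wellFoundedLT
  left_selfInjective := hA
  right_selfInjective := by
    have hN : IsNoetherian Aᵐᵒᵖ A :=
      isNoetherian_iff'.mpr hA.leftAnnihilator_strictAnti.wellFoundedGT
    refine Module.Baer.injective fun I g ↦ ?_
    let ψ : A →ₗ[Aᵐᵒᵖ] Aᵐᵒᵖ :=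
      { toFun := MulOpposite.op
        map_add' := fun _ _ ↦ rfl
        map_smul' := fun _ _ ↦ rfl }
    obtain ⟨c, hc⟩ := hA.exists_eq_mul_of_fg (Submodule.comap ψ I) (IsNoetherian.noetherian _)
      (g ∘ₗ ψ.restrict fun _ h ↦ h)
    refine ⟨LinearMap.toSpanSingleton Aᵐᵒᵖ A c, fun x hx ↦ ?_⟩
    exact (hc ⟨x.unop, hx⟩).symm

end IsLeftSelfInjective

end QuasiFrobenius

theorem mainTheorem3 (A : Type*) [Ring A] [IsSemiprimaryRing A]
    (hA : IsLeftSelfInjective A) :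
    (Cardinal.mk (A ⧸ Ring.jacobson A) ≤ Cardinal.aleph0 → IsQuasiFrobenius A) ∧
      (Cardinal.mk (A ⧸ Ring.jacobson A) < Cardinal.mk A → IsQuasiFrobenius A) := by
  have key (h : Cardinal.mk A ≤ Cardinal.aleph0 ∨
      Cardinal.mk (A ⧸ Ring.jacobson A) < Cardinal.mk A) : IsQuasiFrobenius A :=
    have : IsArtinianRing A := hA.isArtinian_of_mk h
    hA.isQuasiFrobenius
  refine ⟨fun h ↦ key ?_, fun h ↦ key (.inr h)⟩
  by_cases hc : Cardinal.mk A ≤ Cardinal.aleph0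
  · exact .inl hc
  · exact .inr (h.trans_lt (not_le.mp hc))
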